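/- Let $d\ge 2$ and let $U\subset\mathbb R^d$ be an open set satisfying the strong local Lipschitz condition of Adams: there are $\delta>0$, $L\ge 0$, $R\in\mathbb N$, a locally finite open cover $(O_j)$ of $\partial U$ such that any $R+1$ of the sets $O_j$ have empty intersection, and $L$-Lipschitz functions $\gamma_j:\mathbb R^{d-1}\to\mathbb R$, such that any two points $x,y\in U$ with $\operatorname{dist}(x,\partial U)<\delta$, $\operatorname{dist}(y,\partial U)<\delta$ and $|x-y|<\delta$ lie in a common set $\{z\in O_j:\operatorname{dist}(z,\partial O_j)>\delta\}$ and, for each $j$, in suitable Cartesian coordinates $\zeta=(\zeta',\zeta_d)$, $U\cap O_j=\{\zeta\in O_j:\zeta_d<\gamma_j(\zeta')\}$ (the distance to $\emptyset$ being $+\infty$). Let $\lambda>\tfrac12$, let $\alpha\in\mathbb C\setminus\{0\}$ with $\operatorname{Re}\alpha\ge 0$, let $x_0\in\mathbb R^d$, put $\omega(x)=\cosh(|x-x_0|)$, and let $f\in L^2(U)$ be a complex-valued function which vanishes almost everywhere in $U$ outside some compact subset of $\mathbb R^d$. Then each of the following problems has exactly one weak solution $u\in H^1(U)$ (complex-valued):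 1. (Robin) $(-\Delta+\lambda)u=f$ in $U$, $\partial_\nu u+\alpha u=0$ on $\partial U$, that is, $$\int_U\nabla u\cdot\overline{\nabla v}\,dx+\lambda\int_U u\,\overline v\,dx+\alpha\int_{\partial U}u\,\overline v\,dS=\int_U f\,\overline v\,dx\qquad\text{for all }v\in H^1(U),$$ where the boundary values are the traces in $L^2(\partial U)$ (limits of the boundary values of functions in $C_c^\infty(\mathbb R^d)$ whose restrictions to $U$ converge in $H^1(U)$) and $dS$ is the $(d-1)$-dimensional Hausdorff measure; 2. (Neumann) $(-\Delta+\lambda)u=f$ in $U$, $\partial_\nu u=0$ on $\partial U$, that is, $$\int_U\nabla u\cdot\overline{\nabla v}\,dx+\lambda\int_U u\,\overline v\,dx=\int_U f\,\overline v\,dx\qquad\text{for all }v\in H^1(U);$$ 3. (Dirichlet) $(-\Delta+\lambda)u=f$ in $U$, $u=0$ on $\partial U$, that is, $u\in H^1_0(U)$ and the identity in 2 holds for all $v\in H^1_0(U)$, where $H^1_0(U)$ is the closure of $C_c^\infty(U)$ in $H^1(U)$. In each of the three cases the solution satisfies $$\int_U|u|^2\omega\,dx\le M\int_U|f|^2\omega\,dx,\qquad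 \int_U|\nabla u|^2\omega\,dx\le M\int_U|f|^2\omega\,dx,\qquad M=\max\Bigl\{2,\bigl(\lambda-\tfrac12\bigr)^{-1}\Bigr\},$$ where in particular the integrals on the left are finite. -/

import Mathlib

open MeasureTheory Filter Topology
open scoped NNReal ENNReal ContDiff

noncomputable section

namespace WeightedDecay

/-- The Euclidean space `ℝ^d`. -/
abbrev Euc (d : ℕ) : Type := EuclideanSpace ℝ (Fin d)

/-- The strong local Lipschitz condition on a subset `U` of `ℝ^d` (Adams, *Sobolev Spaces*).
There are `δ > 0`, a constant `L`, a locally finite open cover `(O j)` of the boundary of `U`, and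
real functions `γ j` of `d - 1` real variables such that
* for some finite `R`, any `R + 1` of the sets `O j` have empty intersection;
* any two points of `{x ∈ U : dist (x, ∂U) < δ}` at distance less than `δ` lie in a common set
  `{x ∈ O j : dist (x, ∂(O j)) > δ}`;
* every `γ j` is Lipschitz with constant `L`;
* in a Cartesian coordinate system `T j`, the set `U ∩ O j` is the part of `O j` in which the last
  coordinate is smaller than `γ j` of the other ones.
The distance to the empty set is infinite, whence the extended distance `Metric.infEDist`. -/
def StrongLocalLipschitz {d : ℕ} (U : Set (Euc d)) : Prop :=
  ∃ (δ : ℝ) (L : ℝ≥0) (R : ℕ) (ι : Type) (O : ι → Set (Euc d))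
    (γ : ι → Euc (d - 1) → ℝ) (T : ι → (Euc d ≃ᵃⁱ[ℝ] WithLp 2 (Euc (d - 1) × ℝ))),
    0 < δ ∧
    (∀ j, IsOpen (O j)) ∧
    LocallyFinite O ∧
    frontier U ⊆ ⋃ j, O j ∧
    (∀ s : Finset ι, s.card = R + 1 → ⋂ j ∈ s, O j = ∅) ∧
    (∀ x ∈ U, ∀ y ∈ U,
      Metric.infEDist x (frontier U) < ENNReal.ofReal δ →
      Metric.infEDist y (frontier U) < ENNReal.ofReal δ →
      dist x y < δ →
      ∃ j, (x ∈ O j ∧ ENNReal.ofReal δ < Metric.infEDist x (frontier (O j))) ∧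
        (y ∈ O j ∧ ENNReal.ofReal δ < Metric.infEDist y (frontier (O j)))) ∧
    (∀ j, LipschitzWith L (γ j)) ∧
    (∀ j, U ∩ O j = {x | x ∈ O j ∧ (T j x).snd < γ j (T j x).fst})

/-- Lebesgue measure on `U`. -/
abbrev vol {d : ℕ} (U : Set (Euc d)) : Measure (Euc d) := volume.restrict U

/-- Surface measure on the boundary of `U`: the `(d - 1)`-dimensional Hausdorff measure, normalized
so as to agree with Lebesgue measure on hyperplanes. -/
abbrev surface {d : ℕ} (U : Set (Euc d)) : Measure (Euc d) :=
  (Measure.euclideanHausdorffMeasure (d - 1)).restrict (frontier U)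

/-- The partial derivative `∂ᵢ φ (x)`. -/
def pderiv {d : ℕ} (φ : Euc d → ℂ) (i : Fin d) (x : Euc d) : ℂ :=
  fderiv ℝ φ x (EuclideanSpace.single i (1 : ℝ))

/-- The classical gradient of a complex function. -/
def cgrad {d : ℕ} (φ : Euc d → ℂ) (x : Euc d) : EuclideanSpace ℂ (Fin d) :=
  WithLp.toLp 2 fun i => pderiv φ i x

/-- The Sobolev space `H^1(U)` of complex functions: the functions in `L^2(U)` together with
their weak gradient, which is in `L^2(U)` too. -/
@[ext]
structure H1 {d : ℕ} (U : Set (Euc d)) where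
  /-- the function -/
  val : Lp ℂ 2 (vol U)
  /-- its weak gradient -/
  grad : Lp (EuclideanSpace ℂ (Fin d)) 2 (vol U)
  /-- the definition of the weak gradient, by test functions in `C_c^∞(U)` -/
  isWeakGrad : ∀ φ : Euc d → ℂ, ContDiff ℝ ∞ φ → HasCompactSupport φ → tsupport φ ⊆ U →
    ∀ i : Fin d, ∫ x in U, val x * pderiv φ i x = -∫ x in U, grad x i * φ x

/-- The restrictions to `U` of the smooth functions `φ n` tend to `u` in `H^1(U)`. -/
def TendstoH1 {d : ℕ} {U : Set (Euc d)} (φ : ℕ → Euc d → ℂ) (u : H1 U) : Prop :=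
  Tendsto (fun n => eLpNorm (fun x => φ n x - u.val x) 2 (vol U)) atTop (𝓝 0) ∧
  Tendsto (fun n => eLpNorm (fun x => cgrad (φ n) x - u.grad x) 2 (vol U)) atTop (𝓝 0)

/-- Membership in `H^1_0(U)`, the closure of `C_c^∞(U)` in `H^1(U)`. -/
def MemH10 {d : ℕ} {U : Set (Euc d)} (u : H1 U) : Prop :=
  ∃ φ : ℕ → Euc d → ℂ,
    (∀ n, ContDiff ℝ ∞ (φ n) ∧ HasCompactSupport (φ n) ∧ tsupport (φ n) ⊆ U) ∧ TendstoH1 φ u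

/-- `g` in `L^2(∂U)` is the trace of `u` in `H^1(U)`: there are functions in `C_c^∞(ℝ^d)` whose
restrictions to `U` tend to `u` in `H^1(U)` and whose restrictions to `∂U` tend to `g` in
`L^2(∂U)`. (Under the strong local Lipschitz condition every `u` has exactly one trace; neither
existence nor uniqueness is part of this definition.) -/
def IsTrace {d : ℕ} {U : Set (Euc d)} (u : H1 U) (g : Lp ℂ 2 (surface U)) : Prop :=
  ∃ φ : ℕ → Euc d → ℂ,
    (∀ n, ContDiff ℝ ∞ (φ n) ∧ HasCompactSupport (φ n)) ∧ TendstoH1 φ u ∧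
    Tendsto (fun n => eLpNorm (fun x => φ n x - g x) 2 (surface U)) atTop (𝓝 0)

/-- The sesquilinear form `∫_U ∇u · conj ∇v + lam ∫_U u conj v` of `-Δ + lam`. -/
def form {d : ℕ} {U : Set (Euc d)} (lam : ℝ) (u v : H1 U) : ℂ :=
  (∫ x in U, ∑ i, u.grad x i * starRingEnd ℂ (v.grad x i)) +
    (lam : ℂ) * ∫ x in U, u.val x * starRingEnd ℂ (v.val x)

/-- The right-hand side `∫_U f conj v`. -/
def rhs {d : ℕ} {U : Set (Euc d)} (f : Lp ℂ 2 (vol U)) (v : H1 U) : ℂ :=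
  ∫ x in U, f x * starRingEnd ℂ (v.val x)

/-- `u` is a weak solution of `(-Δ + lam) u = f` in `U`, `∂_ν u + α u = 0` on `∂U`. -/
def IsRobinSolution {d : ℕ} {U : Set (Euc d)} (lam : ℝ) (α : ℂ) (f : Lp ℂ 2 (vol U))
    (u : H1 U) : Prop :=
  ∃ g : Lp ℂ 2 (surface U), IsTrace u g ∧
    ∀ (v : H1 U) (h : Lp ℂ 2 (surface U)), IsTrace v h →
      form lam u v + α * ∫ x, g x * starRingEnd ℂ (h x) ∂(surface U) = rhs f v

/-- `u` is a weak solution of `(-Δ + lam) u = f` in `U`, `∂_ν u = 0` on `∂U`. -/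
def IsNeumannSolution {d : ℕ} {U : Set (Euc d)} (lam : ℝ) (f : Lp ℂ 2 (vol U))
    (u : H1 U) : Prop :=
  ∀ v : H1 U, form lam u v = rhs f v

/-- `u` is a weak solution of `(-Δ + lam) u = f` in `U`, `u = 0` on `∂U`. -/
def IsDirichletSolution {d : ℕ} {U : Set (Euc d)} (lam : ℝ) (f : Lp ℂ 2 (vol U))
    (u : H1 U) : Prop :=
  MemH10 u ∧ ∀ v : H1 U, MemH10 v → form lam u v = rhs f v

/-- The weight `ω(x) = cosh |x - x₀|`. -/
def weight {d : ℕ} (x₀ x : Euc d) : ℝ := Real.cosh ‖x - x₀‖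

/-- The two weighted estimates: `|u|²ω` and `|∇u|²ω` are integrable over `U`, with integrals at
most `M ∫_U |f|²ω`. -/
def WeightedBounds {d : ℕ} {U : Set (Euc d)} (M : ℝ) (x₀ : Euc d) (f : Lp ℂ 2 (vol U))
    (u : H1 U) : Prop :=
  (IntegrableOn (fun x => ‖u.val x‖ ^ 2 * weight x₀ x) U ∧
    ∫ x in U, ‖u.val x‖ ^ 2 * weight x₀ x ≤ M * ∫ x in U, ‖f x‖ ^ 2 * weight x₀ x) ∧
  (IntegrableOn (fun x => ‖u.grad x‖ ^ 2 * weight x₀ x) U ∧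
    ∫ x in U, ‖u.grad x‖ ^ 2 * weight x₀ x ≤ M * ∫ x in U, ‖f x‖ ^ 2 * weight x₀ x)

end WeightedDecay

end

/-!
Each of the three problems is a variational problem on a closed subspace of the Hilbert space
`L²(U) × L²(U)^d × L²(∂U)`, whose elements are triples `(u, ∇u, g)` of a function, its weak
gradient, and boundary values. For Robin conditions the subspace is the closure of the triples
`(φ|_U, ∇φ|_U, φ|_∂U)` with `φ` in `C_c^∞(ℝ^d)`: by `isApprox_iff`, it consists of the triples in
which `g` is a trace of `u`. For Dirichlet conditions `C_c^∞(ℝ^d)` is replaced by `C_c^∞(U)`, and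
`g = 0` is automatic; for Neumann conditions the subspace is `H^1(U) × {0}`. As the boundary values
are part of the Hilbert space, the Robin form `P + α Q`, with `P = ∫ |∇u|² + lam |u|²` and
`Q = ∫ |g|²`, is bounded without any trace inequality. It is coercive because `α ≠ 0` and
`Re α ≥ 0` give `|P + α Q| ≥ (P + |α| Q) / 2` (`robinOp_coercive`). The Lax–Milgram theorem gives
existence and uniqueness, uniqueness of `g` included (`existsUnique_solution`).

For the weighted estimates the equation is tested with `η u`, where `η` is a smooth bounded weight
with `|∇η| ≤ η`; multiplication by `η` preserves all the spaces involved (`IsSlowWeight.mulH1`,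
`IsApprox.mul`), and the boundary term has nonnegative real part. With `A = ∫ |∇u|² η`,
`B = ∫ |u|² η`, `F = ∫ |f|² η` and `C = ∫ |∇u| |u| η` this gives `A - C + lam B ≤ √(F B)`. Now
`C ≤ A + B / 4` leads to `B ≤ (lam - 1/4)⁻² F ≤ (lam - 1/2)⁻¹ F`, and `C ≤ (A + B) / 2` leads to
`A ≤ (2 lam - 1)⁻¹ F` (`IsSlowWeight.integral_le`). The weight `cosh |x - x₀|` itself is neither
bounded nor, in its formula, evidently smooth; it is the limit as `ε → 0` of the weights
`c / (1 + ε c)`, `c = cosh √(ε² + |x - x₀|²)`, which are at most `e^ε cosh |x - x₀|`. Fatou's lemma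
carries the estimates over (`integral_weight_le`); the right-hand side stays finite since `f`
vanishes outside a compact set.
-/

namespace WeightedDecay

variable {d : ℕ}

/-! ### Smooth bounded weights -/

/-- A smooth bounded weight whose gradient is dominated by the weight itself: multiplication by
such a function preserves all the Sobolev spaces in play. -/
structure IsSlowWeight (η : Euc d → ℝ) : Prop where
  contDiff : ContDiff ℝ ∞ η
  nonneg : ∀ x, 0 ≤ η x
  bdd : ∃ C, ∀ x, η x ≤ C
  norm_fderiv_le : ∀ x, ‖fderiv ℝ η x‖ ≤ η x

/-- A smooth bounded substitute for `weight x₀`: the function `c / (1 + ε c)` with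
`c = cosh √(ε² + |x - x₀|²)`. The `ε²` removes the singularity of the norm at the origin, and the
denominator makes the function bounded. -/
noncomputable def regWeight (ε : ℝ) (x₀ x : Euc d) : ℝ :=
  Real.cosh √(ε ^ 2 + ‖x - x₀‖ ^ 2) / (1 + ε * Real.cosh √(ε ^ 2 + ‖x - x₀‖ ^ 2))

lemma exists_hasFDerivAt_sqrt_norm_le_one {ε : ℝ} (hε : 0 < ε) (x₀ x : Euc d) :
    ∃ F' : Euc d →L[ℝ] ℝ, HasFDerivAt (fun x => √(ε ^ 2 + ‖x - x₀‖ ^ 2)) F' x ∧ ‖F'‖ ≤ 1 := by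
  have hs : 0 < ε ^ 2 + ‖x - x₀‖ ^ 2 := by positivity
  have h1 := (((hasFDerivAt_id x).sub_const x₀).norm_sq.const_add (ε ^ 2)).sqrt hs.ne'
  refine ⟨_, h1, ?_⟩
  have hx : ‖x - x₀‖ ≤ √(ε ^ 2 + ‖x - x₀‖ ^ 2) := Real.le_sqrt_of_sq_le (by nlinarith [sq_nonneg ε])
  have hp : 0 < √(ε ^ 2 + ‖x - x₀‖ ^ 2) := Real.sqrt_pos.mpr hs
  refine ContinuousLinearMap.opNorm_le_bound _ zero_le_one fun v => ?_
  have hv : |inner ℝ (x - x₀) v| ≤ ‖x - x₀‖ * ‖v‖ := abs_real_inner_le_norm _ _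
  have : ‖inner ℝ (x - x₀) v‖ ≤ √(ε ^ 2 + ‖x - x₀‖ ^ 2) * ‖v‖ :=
    hv.trans (by gcongr)
  simp only [id_eq, ContinuousLinearMap.comp_id, smul_apply,
    innerSL_apply_apply, smul_eq_mul, nsmul_eq_mul, norm_mul, one_mul]
  rw [Real.norm_of_nonneg (by positivity)]
  simp only [Nat.cast_ofNat, Real.norm_ofNat]
  rw [one_div, ← div_eq_inv_mul, div_le_iff₀ (by positivity)]
  linarith

lemma isSlowWeight_regWeight {ε : ℝ} (hε : 0 < ε) (x₀ : Euc d) :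
    IsSlowWeight (regWeight ε x₀) where
  contDiff := by
    have hs : ContDiff ℝ ∞ fun x : Euc d => √(ε ^ 2 + ‖x - x₀‖ ^ 2) :=
      (contDiff_const.add ((contDiff_id.sub contDiff_const).norm_sq ℝ)).sqrt
        fun x => by positivity
    refine hs.cosh.div (contDiff_const.add (contDiff_const.mul hs.cosh)) fun x => ?_
    have := Real.cosh_pos √(ε ^ 2 + ‖x - x₀‖ ^ 2)
    positivity
  nonneg x := by
    have := Real.cosh_pos √(ε ^ 2 + ‖x - x₀‖ ^ 2)
    unfold regWeight
    positivity
  bdd := by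
    refine ⟨ε⁻¹, fun x => ?_⟩
    have := Real.cosh_pos √(ε ^ 2 + ‖x - x₀‖ ^ 2)
    unfold regWeight
    rw [div_le_iff₀ (by positivity), mul_add, inv_mul_cancel_left₀ hε.ne']
    have : 0 < ε⁻¹ := by positivity
    linarith
  norm_fderiv_le x := by
    obtain ⟨F', hF, hF1⟩ := exists_hasFDerivAt_sqrt_norm_le_one hε x₀ x
    set t := √(ε ^ 2 + ‖x - x₀‖ ^ 2) with ht
    have hc := Real.cosh_pos t
    have hD : 0 < 1 + ε * Real.cosh t := by positivity
    have h1 : HasDerivAt (fun t => Real.cosh t / (1 + ε * Real.cosh t))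
        ((Real.sinh t * (1 + ε * Real.cosh t) - Real.cosh t * (ε * Real.sinh t)) /
          (1 + ε * Real.cosh t) ^ 2) t :=
      (Real.hasDerivAt_cosh t).div (((Real.hasDerivAt_cosh t).const_mul ε).const_add 1) hD.ne'
    have h2 := h1.comp_hasFDerivAt x hF
    have h3 : fderiv ℝ (regWeight ε x₀) x = _ := h2.fderiv
    rw [h3, norm_smul]
    have hsc : |Real.sinh t| ≤ Real.cosh t := by
      rw [abs_le]
      constructor <;> nlinarith [Real.exp_pos t, Real.exp_pos (-t), Real.cosh_add_sinh t,
        Real.cosh_sub_sinh t]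
    have h3 : ‖(Real.sinh t * (1 + ε * Real.cosh t) - Real.cosh t * (ε * Real.sinh t)) /
          (1 + ε * Real.cosh t) ^ 2‖ ≤ regWeight ε x₀ x := by
      have e1 : Real.sinh t * (1 + ε * Real.cosh t) - Real.cosh t * (ε * Real.sinh t)
        = Real.sinh t := by ring
      rw [e1, norm_div, Real.norm_eq_abs, Real.norm_of_nonneg (by positivity), regWeight, ← ht]
      gcongr
      nlinarith [mul_pos hε hc]
    calc _ ≤ regWeight ε x₀ x * 1 := by gcongr; exact (norm_nonneg _).trans h3
      _ = _ := mul_one _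

lemma regWeight_le {ε : ℝ} (hε : 0 < ε) (x₀ x : Euc d) :
    regWeight ε x₀ x ≤ Real.exp ε * weight x₀ x := by
  have hc := Real.cosh_pos √(ε ^ 2 + ‖x - x₀‖ ^ 2)
  have hr := norm_nonneg (x - x₀)
  have h1 : √(ε ^ 2 + ‖x - x₀‖ ^ 2) ≤ ε + ‖x - x₀‖ :=
    Real.sqrt_le_iff.mpr ⟨by positivity, by nlinarith⟩
  calc regWeight ε x₀ x ≤ Real.cosh √(ε ^ 2 + ‖x - x₀‖ ^ 2) :=
        div_le_self hc.le (by nlinarith)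
    _ ≤ Real.cosh (ε + ‖x - x₀‖) := by
        rw [Real.cosh_le_cosh, abs_of_nonneg (Real.sqrt_nonneg _), abs_of_nonneg (by positivity)]
        exact h1
    _ ≤ Real.exp ε * weight x₀ x := by
        rw [Real.cosh_add, weight, ← Real.cosh_add_sinh ε, add_mul]
        have := Real.sinh_nonneg_iff.mpr hε.le
        gcongr
        exact (Real.sinh_lt_cosh _).le

lemma tendsto_regWeight (x₀ x : Euc d) :
    Tendsto (fun ε => regWeight ε x₀ x) (𝓝 0) (𝓝 (weight x₀ x)) := by
  have h : ContinuousAt (fun ε => regWeight ε x₀ x) 0 := by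
    unfold regWeight
    refine ContinuousAt.div ?_ ?_ (by simp) <;> fun_prop
  simpa [ContinuousAt, regWeight, weight] using h

lemma continuous_weight (x₀ : Euc d) : Continuous (weight x₀) := by
  unfold weight
  fun_prop

lemma weight_pos (x₀ x : Euc d) : 0 < weight x₀ x := Real.cosh_pos _

/-! ### Partial derivatives and products -/

/-- A real weight seen as a complex function. -/
abbrev toC (η : Euc d → ℝ) : Euc d → ℂ := fun x => (η x : ℂ)

lemma contDiff_toC {η : Euc d → ℝ} (h : ContDiff ℝ ∞ η) : ContDiff ℝ ∞ (toC η) :=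
  Complex.ofRealCLM.contDiff.comp h

lemma continuous_pderiv {φ : Euc d → ℂ} (h : ContDiff ℝ ∞ φ) (i : Fin d) :
    Continuous (pderiv φ i) :=
  (h.continuous_fderiv (by simp)).clm_apply continuous_const

lemma hasCompactSupport_pderiv {φ : Euc d → ℂ} (h : HasCompactSupport φ) (i : Fin d) :
    HasCompactSupport (pderiv φ i) :=
  h.fderiv_apply ℝ _

lemma continuous_cgrad {φ : Euc d → ℂ} (h : ContDiff ℝ ∞ φ) : Continuous (cgrad φ) :=
  (PiLp.continuous_toLp 2 _).comp (continuous_pi fun i => continuous_pderiv h i)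

lemma hasCompactSupport_cgrad {φ : Euc d → ℂ} (h : HasCompactSupport φ) :
    HasCompactSupport (cgrad φ) := by
  refine (h.fderiv ℝ).mono fun x hx => ?_
  contrapose! hx
  simp only [Function.mem_support, not_not] at hx ⊢
  ext i
  simp [cgrad, pderiv, hx]

lemma pderiv_mul {ψ φ : Euc d → ℂ} (hψ : ContDiff ℝ ∞ ψ) (hφ : ContDiff ℝ ∞ φ) (i : Fin d)
    (x : Euc d) :
    pderiv (fun x => ψ x * φ x) i x = ψ x * pderiv φ i x + φ x * pderiv ψ i x := by
  have h1 := (hψ.differentiable (by simp)) x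
  have h2 := (hφ.differentiable (by simp)) x
  simp [pderiv, fderiv_fun_mul h1 h2]

lemma cgrad_mul {ψ φ : Euc d → ℂ} (hψ : ContDiff ℝ ∞ ψ) (hφ : ContDiff ℝ ∞ φ) (x : Euc d) :
    cgrad (fun x => ψ x * φ x) x = ψ x • cgrad φ x + φ x • cgrad ψ x := by
  ext i
  simp [cgrad, pderiv_mul hψ hφ]

lemma cgrad_add {ψ φ : Euc d → ℂ} (hψ : ContDiff ℝ ∞ ψ) (hφ : ContDiff ℝ ∞ φ) (x : Euc d) :
    cgrad (fun x => ψ x + φ x) x = cgrad ψ x + cgrad φ x := by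
  have h1 := (hψ.differentiable (by simp)) x
  have h2 := (hφ.differentiable (by simp)) x
  ext i
  simp [cgrad, pderiv, fderiv_fun_add h1 h2]

lemma cgrad_const_mul (c : ℂ) {φ : Euc d → ℂ} (hφ : ContDiff ℝ ∞ φ) (x : Euc d) :
    cgrad (fun x => c * φ x) x = c • cgrad φ x := by
  ext i
  simp [cgrad, pderiv, fderiv_const_mul ((hφ.differentiable (by simp)) x)]

lemma pderiv_toC {η : Euc d → ℝ} (h : ContDiff ℝ ∞ η) (i : Fin d) (x : Euc d) :
    pderiv (toC η) i x = (fderiv ℝ η x (EuclideanSpace.single i 1) : ℝ) := by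
  have h1 := Complex.ofRealCLM.hasFDerivAt.comp x ((h.differentiable (by simp)) x).hasFDerivAt
  have h2 : fderiv ℝ (toC η) x = Complex.ofRealCLM.comp (fderiv ℝ η x) := h1.fderiv
  simp [pderiv, h2]

/-- The Euclidean norm of the coordinate gradient is at most the operator norm of the
differential. -/
lemma norm_cgrad_toC_le {η : Euc d → ℝ} (h : ContDiff ℝ ∞ η) (x : Euc d) :
    ‖cgrad (toC η) x‖ ≤ ‖fderiv ℝ η x‖ := by
  let v : Euc d := WithLp.toLp 2 fun i => fderiv ℝ η x (EuclideanSpace.single i 1)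
  have hn : ‖cgrad (toC η) x‖ = ‖v‖ := by
    simp [EuclideanSpace.norm_eq, cgrad, pderiv_toC h, v]
  have hv : fderiv ℝ η x v = ‖v‖ ^ 2 := by
    have : v = ∑ i, v i • EuclideanSpace.single i (1 : ℝ) := by
      ext j
      simp [Finset.sum_apply, Pi.single_apply]
    conv_lhs => rw [this, map_sum]
    rw [EuclideanSpace.norm_sq_eq]
    simp [v, sq]
  rw [hn]
  rcases eq_or_ne ‖v‖ 0 with h0 | h0
  · rw [h0]; positivity
  · have h1 := (le_abs_self _).trans ((fderiv ℝ η x).le_opNorm v)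
    rw [hv, sq] at h1
    exact le_of_mul_le_mul_right h1 (by positivity)

variable {U : Set (Euc d)} {η : Euc d → ℝ}

/-! ### Multiplication of Sobolev functions by a weight -/

lemma IsSlowWeight.continuous_cgrad (h : IsSlowWeight η) : Continuous (cgrad (toC η)) :=
  WeightedDecay.continuous_cgrad (contDiff_toC h.contDiff)

lemma IsSlowWeight.norm_cgrad_le (h : IsSlowWeight η) (x : Euc d) : ‖cgrad (toC η) x‖ ≤ η x :=
  (norm_cgrad_toC_le h.contDiff x).trans (h.norm_fderiv_le x)

lemma IsSlowWeight.continuous_toC (h : IsSlowWeight η) : Continuous (toC η) :=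
  (contDiff_toC h.contDiff).continuous

lemma IsSlowWeight.norm_toC (h : IsSlowWeight η) (x : Euc d) : ‖toC η x‖ = η x := by
  simp [abs_of_nonneg (h.nonneg x)]

lemma IsSlowWeight.memLp_smul {E : Type*} [NormedAddCommGroup E] [NormedSpace ℂ E]
    (h : IsSlowWeight η) {μ : Measure (Euc d)} {f : Euc d → E} (hf : MemLp f 2 μ) :
    MemLp (fun x => toC η x • f x) 2 μ := by
  obtain ⟨C, hC⟩ := h.bdd
  refine hf.of_le_mul (c := C) (h.continuous_toC.aestronglyMeasurable.smul hf.1)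
    (Eventually.of_forall fun x => ?_)
  rw [norm_smul, h.norm_toC]
  gcongr
  exact hC x

lemma IsSlowWeight.memLp_smul_cgrad (h : IsSlowWeight η) {μ : Measure (Euc d)} {f : Euc d → ℂ}
    (hf : MemLp f 2 μ) : MemLp (fun x => f x • cgrad (toC η) x) 2 μ := by
  obtain ⟨C, hC⟩ := h.bdd
  refine hf.of_le_mul (c := C) (hf.1.smul h.continuous_cgrad.aestronglyMeasurable)
    (Eventually.of_forall fun x => ?_)
  rw [norm_smul, mul_comm]
  gcongr
  exact (h.norm_cgrad_le x).trans (hC x)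

/-- The product of a weight and an `L²` function. -/
noncomputable def IsSlowWeight.mulLp (h : IsSlowWeight η) {μ : Measure (Euc d)} (g : Lp ℂ 2 μ) :
    Lp ℂ 2 μ :=
  (h.memLp_smul (Lp.memLp g)).toLp _

lemma IsSlowWeight.coeFn_mulLp (h : IsSlowWeight η) {μ : Measure (Euc d)} (g : Lp ℂ 2 μ) :
    h.mulLp g =ᵐ[μ] fun x => toC η x • g x :=
  MemLp.coeFn_toLp _

lemma memLp_two_of_continuous_of_hasCompactSupport {E : Type*} [NormedAddCommGroup E]
    {φ : Euc d → E} (h : Continuous φ) (hc : HasCompactSupport φ) : MemLp φ 2 (vol U) :=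
  h.memLp_of_hasCompactSupport hc

lemma IsSlowWeight.memLp_mulGrad (h : IsSlowWeight η) (u : H1 U) :
    MemLp (fun x => toC η x • u.grad x + u.val x • cgrad (toC η) x) 2 (vol U) :=
  (h.memLp_smul (Lp.memLp u.grad)).add (h.memLp_smul_cgrad (Lp.memLp u.val))

/-- The product of a weight `η` and `u` in `H^1(U)`, with gradient `η ∇u + u ∇η`. -/
noncomputable def IsSlowWeight.mulH1 (h : IsSlowWeight η) (u : H1 U) : H1 U where
  val := h.mulLp u.val
  grad := (h.memLp_mulGrad u).toLp _
  isWeakGrad φ hφ hc hs i := by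
    have hη := contDiff_toC h.contDiff
    have hu := Lp.memLp u.val
    have hcφ : HasCompactSupport fun x => toC η x * φ x := hc.mul_left
    have key := u.isWeakGrad (fun x => toC η x * φ x) (hη.mul hφ) hcφ
      ((tsupport_mul_subset_right).trans hs) i
    have i1 : Integrable (fun x => u.val x * (toC η x * pderiv φ i x)) (vol U) :=
      hu.integrable_mul (memLp_two_of_continuous_of_hasCompactSupport
        (hη.continuous.mul (continuous_pderiv hφ i)) (hasCompactSupport_pderiv hc i).mul_left)
    have i2 : Integrable (fun x => u.val x * (φ x * pderiv (toC η) i x)) (vol U) :=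
      hu.integrable_mul (memLp_two_of_continuous_of_hasCompactSupport
        (hφ.continuous.mul (continuous_pderiv hη i)) hc.mul_right)
    have i3 : Integrable (fun x => u.grad x i * (toC η x * φ x)) (vol U) := by
      refine MemLp.integrable_mul (p := 2) (q := 2) ?_
        (memLp_two_of_continuous_of_hasCompactSupport (hη.continuous.mul hφ.continuous) hcφ)
      exact (EuclideanSpace.proj (𝕜 := ℂ) i).comp_memLp' (Lp.memLp u.grad)
    have e1 : ∫ x in U, h.mulLp u.val x * pderiv φ i x =
        ∫ x in U, u.val x * (toC η x * pderiv φ i x) := by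
      refine integral_congr_ae ?_
      filter_upwards [h.coeFn_mulLp u.val] with x hx
      rw [hx, smul_eq_mul]; ring
    have e2 : ∫ x in U, ((h.memLp_mulGrad u).toLp _ : Lp (EuclideanSpace ℂ (Fin d)) 2 (vol U)) x i
          * φ x = ∫ x in U, (u.grad x i * (toC η x * φ x) +
            u.val x * (φ x * pderiv (toC η) i x)) := by
      refine integral_congr_ae ?_
      filter_upwards [MemLp.coeFn_toLp (h.memLp_mulGrad u)] with x hx
      rw [hx]
      simp [cgrad]; ring
    rw [e1, e2, integral_add i3 i2, neg_add, ← key, ← sub_eq_add_neg, eq_sub_iff_add_eq,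
      ← integral_add i1 i2]
    refine integral_congr_ae (Eventually.of_forall fun x => ?_)
    simp only [pderiv_mul hη hφ]
    ring

lemma IsSlowWeight.coeFn_mulH1_val (h : IsSlowWeight η) (u : H1 U) :
    (h.mulH1 u).val =ᵐ[vol U] fun x => toC η x • u.val x :=
  h.coeFn_mulLp u.val

lemma IsSlowWeight.coeFn_mulH1_grad (h : IsSlowWeight η) (u : H1 U) :
    (h.mulH1 u).grad =ᵐ[vol U] fun x => toC η x • u.grad x + u.val x • cgrad (toC η) x :=
  MemLp.coeFn_toLp (h.memLp_mulGrad u)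

/-- The test functions `C_c^∞(V)`. -/
def IsTest (V : Set (Euc d)) (φ : Euc d → ℂ) : Prop :=
  ContDiff ℝ ∞ φ ∧ HasCompactSupport φ ∧ tsupport φ ⊆ V

/-- The common form of the two definitions by approximation: `u` is a limit in `H^1(U)` of smooth
functions with compact support in `V`, and the boundary values of these tend to `g`. The choice
`V = ℝ^d` says that `g` is a trace of `u`, the choice `V = U` that `u` is in `H^1_0(U)` (and
`g = 0`). -/
def IsApprox (V : Set (Euc d)) (u : H1 U) (g : Lp ℂ 2 (surface U)) : Prop :=
  ∃ φ : ℕ → Euc d → ℂ,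
    (∀ n, IsTest V (φ n)) ∧ TendstoH1 φ u ∧
    Tendsto (fun n => eLpNorm (fun x => φ n x - g x) 2 (surface U)) atTop (𝓝 0)

lemma isApprox_univ_iff {u : H1 U} {g : Lp ℂ 2 (surface U)} :
    IsApprox Set.univ u g ↔ IsTrace u g := by
  simp [IsApprox, IsTrace, IsTest]

/-- A function supported in an open set vanishes on the boundary of this set. -/
lemma ae_surface_eq_zero (hU : IsOpen U) {φ : Euc d → ℂ} (hs : tsupport φ ⊆ U) :
    φ =ᵐ[surface U] 0 := by
  refine (ae_restrict_iff' isClosed_frontier.measurableSet).mpr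
    (Eventually.of_forall fun x hx => ?_)
  by_contra h0
  rw [hU.frontier_eq] at hx
  exact hx.2 (hs (subset_tsupport _ h0))

lemma isApprox_self_iff (hU : IsOpen U) {u : H1 U} : IsApprox U u 0 ↔ MemH10 u := by
  constructor
  · rintro ⟨φ, h1, h2, -⟩
    exact ⟨φ, h1, h2⟩
  · rintro ⟨φ, h1, h2⟩
    refine ⟨φ, h1, h2, ?_⟩
    have (n : ℕ) : eLpNorm (fun x => φ n x - (0 : Lp ℂ 2 (surface U)) x) 2 (surface U) = 0 := by
      rw [← eLpNorm_zero (μ := surface U) (p := 2) (ε := ℂ)]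
      refine eLpNorm_congr_ae ?_
      filter_upwards [ae_surface_eq_zero hU (h1 n).2.2, Lp.coeFn_zero ℂ 2 (surface U)]
        with x hx hx'
      rw [hx, hx']
      simp
    simp only [this, tendsto_const_nhds]

lemma IsSlowWeight.tendsto_eLpNorm_mulLp (h : IsSlowWeight η) {μ : Measure (Euc d)}
    {φ : ℕ → Euc d → ℂ} {g : Lp ℂ 2 μ}
    (hg : Tendsto (fun n => eLpNorm (fun x => φ n x - g x) 2 μ) atTop (𝓝 0)) :
    Tendsto (fun n => eLpNorm (fun x => toC η x * φ n x - h.mulLp g x) 2 μ) atTop (𝓝 0) := by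
  obtain ⟨C, hC⟩ := h.bdd
  have hlim : Tendsto (fun n => ENNReal.ofReal C * eLpNorm (fun x => φ n x - g x) 2 μ) atTop
      (𝓝 0) := by
    simpa using ENNReal.Tendsto.const_mul hg (Or.inr ENNReal.ofReal_ne_top)
  refine tendsto_of_tendsto_of_tendsto_of_le_of_le tendsto_const_nhds hlim (fun _ => zero_le)
    fun n => ?_
  refine eLpNorm_le_mul_eLpNorm_of_ae_le_mul ?_ 2
  filter_upwards [h.coeFn_mulLp g] with x hx
  rw [hx, smul_eq_mul, ← mul_sub, norm_mul, h.norm_toC]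
  gcongr
  exact hC x

lemma IsSlowWeight.tendstoH1_mulH1 (h : IsSlowWeight η) {φ : ℕ → Euc d → ℂ}
    (hφ : ∀ n, ContDiff ℝ ∞ (φ n)) {u : H1 U} (hu : TendstoH1 φ u) :
    TendstoH1 (fun n x => toC η x * φ n x) (h.mulH1 u) := by
  refine ⟨h.tendsto_eLpNorm_mulLp hu.1, ?_⟩
  obtain ⟨C, hC⟩ := h.bdd
  have hη := contDiff_toC h.contDiff
  have hlim : Tendsto (fun n =>
      ENNReal.ofReal C * eLpNorm (fun x => cgrad (φ n) x - u.grad x) 2 (vol U) +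
      ENNReal.ofReal C * eLpNorm (fun x => φ n x - u.val x) 2 (vol U)) atTop (𝓝 0) := by
    simpa using (ENNReal.Tendsto.const_mul hu.2 (Or.inr ENNReal.ofReal_ne_top)).add
      (ENNReal.Tendsto.const_mul hu.1 (Or.inr ENNReal.ofReal_ne_top))
  refine tendsto_of_tendsto_of_tendsto_of_le_of_le tendsto_const_nhds hlim (fun _ => zero_le)
    fun n => ?_
  have e : eLpNorm (fun x => cgrad (fun x => toC η x * φ n x) x - (h.mulH1 u).grad x) 2 (vol U) =
      eLpNorm ((fun x => toC η x • (cgrad (φ n) x - u.grad x)) +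
        fun x => (φ n x - u.val x) • cgrad (toC η) x) 2 (vol U) := by
    refine eLpNorm_congr_ae ?_
    filter_upwards [h.coeFn_mulH1_grad u] with x hx
    simp only [hx, cgrad_mul hη (hφ n), Pi.add_apply, smul_sub, sub_smul]
    abel
  have m1 : AEStronglyMeasurable (fun x => cgrad (φ n) x - u.grad x) (vol U) :=
    (WeightedDecay.continuous_cgrad (hφ n)).aestronglyMeasurable.sub (Lp.memLp u.grad).1
  have m2 : AEStronglyMeasurable (fun x => φ n x - u.val x) (vol U) :=
    (hφ n).continuous.aestronglyMeasurable.sub (Lp.memLp u.val).1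
  rw [e]
  refine (eLpNorm_add_le (h.continuous_toC.aestronglyMeasurable.smul m1)
    (m2.smul h.continuous_cgrad.aestronglyMeasurable) (by norm_num)).trans (add_le_add ?_ ?_)
  · refine eLpNorm_le_mul_eLpNorm_of_ae_le_mul (Eventually.of_forall fun x => ?_) 2
    rw [Pi.smul_apply', norm_smul, h.norm_toC]
    gcongr
    exact hC x
  · refine eLpNorm_le_mul_eLpNorm_of_ae_le_mul (Eventually.of_forall fun x => ?_) 2
    rw [Pi.smul_apply', norm_smul, mul_comm]
    gcongr
    exact (h.norm_cgrad_le x).trans (hC x)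

lemma IsApprox.mul {V : Set (Euc d)} {u : H1 U} {g : Lp ℂ 2 (surface U)} (hu : IsApprox V u g)
    (h : IsSlowWeight η) : IsApprox V (h.mulH1 u) (h.mulLp g) := by
  obtain ⟨φ, h1, h2, h3⟩ := hu
  exact ⟨fun n x => toC η x * φ n x,
    fun n => ⟨(contDiff_toC h.contDiff).mul (h1 n).1, (h1 n).2.1.mul_left,
      tsupport_mul_subset_right.trans (h1 n).2.2⟩,
    h.tendstoH1_mulH1 (fun n => (h1 n).1) h2, h.tendsto_eLpNorm_mulLp h3⟩

lemma MemH10.mul (hU : IsOpen U) {u : H1 U} (hu : MemH10 u) (h : IsSlowWeight η) :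
    MemH10 (h.mulH1 u) := by
  obtain ⟨φ, h1, h2, -⟩ := ((isApprox_self_iff hU).mpr hu).mul h
  exact ⟨φ, h1, h2⟩

/-! ### The weighted energy estimate -/

lemma form_eq_inner (lam : ℝ) (u v : H1 U) :
    form lam u v = inner ℂ v.grad u.grad + lam * inner ℂ v.val u.val := by
  simp [form, L2.inner_def, PiLp.inner_apply, RCLike.inner_apply]

lemma rhs_eq_inner (f : Lp ℂ 2 (vol U)) (v : H1 U) : rhs f v = inner ℂ v.val f := by
  simp [rhs, L2.inner_def, RCLike.inner_apply]

lemma re_inner_eq_integral {E : Type*} [NormedAddCommGroup E] [InnerProductSpace ℂ E]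
    {μ : Measure (Euc d)} (f g : Lp E 2 μ) :
    (inner ℂ f g).re = ∫ x, (inner ℂ (f x) (g x)).re ∂μ := by
  rw [L2.inner_def]
  exact (integral_re (L2.integrable_inner (𝕜 := ℂ) f g)).symm

lemma integrable_re_inner {E : Type*} [NormedAddCommGroup E] [InnerProductSpace ℂ E]
    {μ : Measure (Euc d)} (f g : Lp E 2 μ) :
    Integrable (fun x => (inner ℂ (f x) (g x)).re) μ :=
  (L2.integrable_inner (𝕜 := ℂ) f g).re

section

variable {E F : Type*} [NormedAddCommGroup E] [NormedAddCommGroup F] {μ : Measure (Euc d)}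

lemma IsSlowWeight.integrable_norm_mul_norm (h : IsSlowWeight η) {a : Euc d → E} {b : Euc d → F}
    (ha : MemLp a 2 μ) (hb : MemLp b 2 μ) : Integrable (fun x => ‖a x‖ * ‖b x‖ * η x) μ := by
  obtain ⟨C, hC⟩ := h.bdd
  refine (MemLp.integrable_mul ha.norm hb.norm).mul_bdd (c := C)
    h.contDiff.continuous.aestronglyMeasurable (Eventually.of_forall fun x => ?_)
  rw [Real.norm_of_nonneg (h.nonneg x)]
  exact hC x

lemma IsSlowWeight.integrable_norm_sq (h : IsSlowWeight η) {a : Euc d → E}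
    (ha : MemLp a 2 μ) : Integrable (fun x => ‖a x‖ ^ 2 * η x) μ := by
  simpa only [sq] using h.integrable_norm_mul_norm ha ha

lemma IsSlowWeight.integral_norm_mul_norm_le (h : IsSlowWeight η) {a : Euc d → E}
    {b : Euc d → F} (ha : MemLp a 2 μ) (hb : MemLp b 2 μ) {c : ℝ} (hc : 0 < c) :
    ∫ x, ‖a x‖ * ‖b x‖ * η x ∂μ ≤
      c * ∫ x, ‖a x‖ ^ 2 * η x ∂μ + (4 * c)⁻¹ * ∫ x, ‖b x‖ ^ 2 * η x ∂μ := by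
  have i1 := (h.integrable_norm_sq ha).const_mul c
  have i2 := (h.integrable_norm_sq hb).const_mul (4 * c)⁻¹
  rw [← integral_const_mul, ← integral_const_mul, ← integral_add i1 i2]
  refine integral_mono (h.integrable_norm_mul_norm ha hb) (i1.add i2) fun x => ?_
  have key : ‖a x‖ * ‖b x‖ ≤ c * ‖a x‖ ^ 2 + (4 * c)⁻¹ * ‖b x‖ ^ 2 := by
    have e : c * ‖a x‖ ^ 2 + (4 * c)⁻¹ * ‖b x‖ ^ 2 - ‖a x‖ * ‖b x‖ =
        (2 * c * ‖a x‖ - ‖b x‖) ^ 2 * (4 * c)⁻¹ := by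
      field_simp; ring
    have : 0 ≤ (2 * c * ‖a x‖ - ‖b x‖) ^ 2 * (4 * c)⁻¹ := by positivity
    linarith
  have := mul_le_mul_of_nonneg_right key (h.nonneg x)
  linarith

end

lemma IsSlowWeight.re_form_ge (h : IsSlowWeight η) (lam : ℝ) (u : H1 U) :
    (∫ x in U, ‖u.grad x‖ ^ 2 * η x) - (∫ x in U, ‖u.grad x‖ * ‖u.val x‖ * η x) +
      lam * (∫ x in U, ‖u.val x‖ ^ 2 * η x) ≤ (form lam u (h.mulH1 u)).re := by
  have hG := Lp.memLp u.grad
  have hu := Lp.memLp u.val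
  rw [form_eq_inner, Complex.add_re, Complex.re_ofReal_mul, re_inner_eq_integral,
    re_inner_eq_integral, ← integral_sub (h.integrable_norm_sq hG)
      (h.integrable_norm_mul_norm hG hu)]
  have e : ∫ x in U, (inner ℂ ((h.mulH1 u).val x) (u.val x)).re =
      ∫ x in U, ‖u.val x‖ ^ 2 * η x := by
    refine integral_congr_ae ?_
    filter_upwards [h.coeFn_mulH1_val u] with x hx
    have hn : (inner ℂ (u.val x) (u.val x)).re = ‖u.val x‖ ^ 2 :=
      inner_self_eq_norm_sq (𝕜 := ℂ) (u.val x)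
    rw [hx, inner_smul_left, Complex.conj_ofReal, Complex.re_ofReal_mul, hn, mul_comm]
  rw [e]
  gcongr ?_ + _
  refine integral_mono_ae ((h.integrable_norm_sq hG).sub (h.integrable_norm_mul_norm hG hu))
    (integrable_re_inner _ _) ?_
  filter_upwards [h.coeFn_mulH1_grad u] with x hx
  have hn : (inner ℂ (u.grad x) (u.grad x)).re = ‖u.grad x‖ ^ 2 :=
    inner_self_eq_norm_sq (𝕜 := ℂ) (u.grad x)
  have h1 := (neg_le_of_abs_le (Complex.abs_re_le_norm
    (inner ℂ (u.val x • cgrad (toC η) x) (u.grad x))))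
  have h2 : ‖inner ℂ (u.val x • cgrad (toC η) x) (u.grad x)‖ ≤
      ‖u.grad x‖ * ‖u.val x‖ * η x := by
    refine (norm_inner_le_norm _ _).trans ?_
    rw [norm_smul, mul_comm, ← mul_assoc]
    gcongr
    exact h.norm_cgrad_le x
  change _ ≤ (inner ℂ ((h.mulH1 u).grad x) (u.grad x)).re
  rw [hx, inner_add_left, Complex.add_re, inner_smul_left, Complex.conj_ofReal,
    Complex.re_ofReal_mul, hn]
  linarith

lemma IsSlowWeight.re_rhs_le (h : IsSlowWeight η) (f : Lp ℂ 2 (vol U)) (u : H1 U) :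
    (rhs f (h.mulH1 u)).re ≤ ∫ x in U, ‖u.val x‖ * ‖f x‖ * η x := by
  rw [rhs_eq_inner, re_inner_eq_integral]
  refine integral_mono_ae (integrable_re_inner _ _)
    (h.integrable_norm_mul_norm (Lp.memLp u.val) (Lp.memLp f)) ?_
  filter_upwards [h.coeFn_mulH1_val u] with x hx
  refine (Complex.re_le_norm _).trans ((norm_inner_le_norm _ _).trans ?_)
  rw [hx, norm_smul, h.norm_toC]
  exact le_of_eq (by ring)

/-- The weighted estimates for bounded weights, by testing the equation with `η u`. With
`B = ∫ |u|² η`, `A = ∫ |∇u|² η`, `F = ∫ |f|² η`, the bound `|∇η| ≤ η` and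
`|∇u| |u| ≤ |∇u|² + |u|² / 4` give `(lam - 1/4) B ≤ √(F B)`, hence `B ≤ (lam - 1/4)⁻² F`; and
`(lam - 1/4)² ≥ lam - 1/2` since `(lam - 3/4)² ≥ 0`. -/
lemma IsSlowWeight.integral_le (h : IsSlowWeight η) {lam : ℝ} (hlam : 1 / 2 < lam)
    {f : Lp ℂ 2 (vol U)} {u : H1 U}
    (hu : (form lam u (h.mulH1 u)).re ≤ (rhs f (h.mulH1 u)).re) :
    ∫ x in U, ‖u.val x‖ ^ 2 * η x ≤ max 2 (lam - 1 / 2)⁻¹ * ∫ x in U, ‖f x‖ ^ 2 * η x ∧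
    ∫ x in U, ‖u.grad x‖ ^ 2 * η x ≤ max 2 (lam - 1 / 2)⁻¹ * ∫ x in U, ‖f x‖ ^ 2 * η x := by
  have hG := Lp.memLp u.grad
  have hv := Lp.memLp u.val
  have h0 := (h.re_form_ge lam u).trans (hu.trans (h.re_rhs_le f u))
  have h1 := h.integral_norm_mul_norm_le hG hv one_pos
  have h2 := h.integral_norm_mul_norm_le hG hv (c := 1 / 2) (by norm_num)
  have h3 := h.integral_norm_mul_norm_le hv (Lp.memLp f) (c := (lam - 1 / 4) / 2) (by linarith)
  have h4 := h.integral_norm_mul_norm_le hv (Lp.memLp f) (c := lam - 1 / 2) (by linarith)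
  have hF : 0 ≤ ∫ x in U, ‖f x‖ ^ 2 * η x :=
    integral_nonneg fun x => mul_nonneg (by positivity) (h.nonneg x)
  set A := ∫ x in U, ‖u.grad x‖ ^ 2 * η x
  set B := ∫ x in U, ‖u.val x‖ ^ 2 * η x
  set F := ∫ x in U, ‖f x‖ ^ 2 * η x
  set κ := lam - 1 / 2 with hκ
  have hκ0 : 0 < κ := by linarith
  have ek : lam - 1 / 4 = κ + 1 / 4 := by rw [hκ]; ring
  have el : lam = κ + 1 / 2 := by rw [hκ]; ring
  rw [ek] at h3
  constructor
  · have hB : B ≤ F / (κ + 1 / 4) ^ 2 := by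
      rw [le_div_iff₀ (by positivity)]
      have e : (4 * ((κ + 1 / 4) / 2))⁻¹ * F = F / (2 * (κ + 1 / 4)) := by field_simp; ring
      have h5 : (κ + 1 / 4) / 2 * B ≤ F / (2 * (κ + 1 / 4)) := by
        rw [← e]
        rw [el] at h0
        linarith
      rw [le_div_iff₀ (by positivity)] at h5
      linarith
    refine hB.trans ?_
    rw [div_eq_inv_mul]
    gcongr
    exact le_max_of_le_right (inv_anti₀ hκ0 (by nlinarith [sq_nonneg (κ - 1 / 4)]))
  · have hA : A ≤ (2 * κ)⁻¹ * F := by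
      have e : (2 * κ)⁻¹ * F = 2 * ((4 * κ)⁻¹ * F) := by field_simp; ring
      rw [el] at h0
      linarith
    refine hA.trans ?_
    gcongr
    exact le_max_of_le_right (inv_anti₀ hκ0 (by linarith))

/-- An estimate that holds for all the weights `regWeight ε x₀` holds for their limit
`weight x₀`, by Fatou's lemma. -/
lemma integral_weight_le {E : Type*} [NormedAddCommGroup E] {a : Euc d → E}
    (ha : AEStronglyMeasurable a (vol U)) {N : ℝ} (x₀ : Euc d)
    (hi : ∀ ε > 0, Integrable (fun x => ‖a x‖ ^ 2 * regWeight ε x₀ x) (vol U))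
    (h : ∀ ε > 0, ∫ x in U, ‖a x‖ ^ 2 * regWeight ε x₀ x ≤ Real.exp ε * N) :
    IntegrableOn (fun x => ‖a x‖ ^ 2 * weight x₀ x) U ∧
      ∫ x in U, ‖a x‖ ^ 2 * weight x₀ x ≤ N := by
  have hm : AEStronglyMeasurable (fun x => ‖a x‖ ^ 2 * weight x₀ x) (vol U) :=
    (ha.norm.pow 2).mul (continuous_weight x₀).aestronglyMeasurable
  have h0 : ∀ x, 0 ≤ ‖a x‖ ^ 2 * weight x₀ x := fun x =>
    mul_nonneg (by positivity) (weight_pos x₀ x).le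
  let e : ℕ → ℝ := fun n => 1 / ((n : ℝ) + 1)
  have he0 : ∀ n, 0 < e n := fun n => by positivity
  have he : Tendsto e atTop (𝓝 0) := tendsto_one_div_add_atTop_nhds_zero_nat
  have hN : Tendsto (fun n => ENNReal.ofReal (Real.exp (e n) * N)) atTop
      (𝓝 (ENNReal.ofReal N)) := by
    refine ENNReal.tendsto_ofReal ?_
    simpa using ((Real.continuous_exp.tendsto 0).comp he).mul_const N
  have hle : ∫⁻ x in U, ENNReal.ofReal (‖a x‖ ^ 2 * weight x₀ x) ≤ ENNReal.ofReal N := by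
    calc ∫⁻ x in U, ENNReal.ofReal (‖a x‖ ^ 2 * weight x₀ x)
        = ∫⁻ x in U, liminf (fun n => ENNReal.ofReal (‖a x‖ ^ 2 * regWeight (e n) x₀ x)) atTop := by
          refine lintegral_congr fun x => (Tendsto.liminf_eq ?_).symm
          exact ENNReal.tendsto_ofReal (((tendsto_regWeight x₀ x).comp he).const_mul _)
      _ ≤ liminf (fun n => ∫⁻ x in U, ENNReal.ofReal (‖a x‖ ^ 2 * regWeight (e n) x₀ x)) atTop :=
          lintegral_liminf_le' fun n => (hi _ (he0 n)).1.aemeasurable.ennreal_ofReal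
      _ ≤ liminf (fun n => ENNReal.ofReal (Real.exp (e n) * N)) atTop := by
          refine liminf_le_liminf (Eventually.of_forall fun n => ?_)
          rw [← ofReal_integral_eq_lintegral_ofReal (hi _ (he0 n)) (Eventually.of_forall fun x =>
            mul_nonneg (by positivity) ((isSlowWeight_regWeight (he0 n) x₀).nonneg x))]
          exact ENNReal.ofReal_le_ofReal (h _ (he0 n))
      _ = ENNReal.ofReal N := hN.liminf_eq
  have hint : Integrable (fun x => ‖a x‖ ^ 2 * weight x₀ x) (vol U) :=
    (lintegral_ofReal_ne_top_iff_integrable hm (Eventually.of_forall h0)).mp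
      (hle.trans_lt ENNReal.ofReal_lt_top).ne
  refine ⟨hint, ?_⟩
  have hN0 : 0 ≤ N := by
    have h1 := h 1 one_pos
    have h2 : 0 ≤ ∫ x in U, ‖a x‖ ^ 2 * regWeight 1 x₀ x := integral_nonneg fun x =>
      mul_nonneg (by positivity) ((isSlowWeight_regWeight one_pos x₀).nonneg x)
    exact nonneg_of_mul_nonneg_right (h2.trans h1) (Real.exp_pos 1)
  rw [← ofReal_integral_eq_lintegral_ofReal hint (Eventually.of_forall h0)] at hle
  exact (ENNReal.ofReal_le_ofReal_iff hN0).mp hle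

lemma integrable_weight_of_compact_support {f : Lp ℂ 2 (vol U)}
    (hf : ∃ K : Set (Euc d), IsCompact K ∧ ∀ᵐ x ∂(vol U), x ∉ K → f x = 0) (x₀ : Euc d) :
    Integrable (fun x => ‖f x‖ ^ 2 * weight x₀ x) (vol U) := by
  obtain ⟨K, hK, hfK⟩ := hf
  obtain ⟨C, hC⟩ := hK.exists_bound_of_continuousOn (continuous_weight x₀).continuousOn
  have hi : Integrable (fun x => ‖f x‖ ^ 2) (vol U) := (Lp.memLp f).norm.integrable_sq
  refine (hi.mul_const C).mono
    (hi.1.mul (continuous_weight x₀).aestronglyMeasurable) ?_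
  filter_upwards [hfK] with x hx
  by_cases hxK : x ∈ K
  · rw [norm_mul, norm_mul]
    gcongr
    exact (hC x hxK).trans (le_abs_self C)
  · simp [hx hxK]

/-- The weighted bounds hold as soon as all the tests with `η u` are allowed and the boundary term
has the good sign. -/
lemma weightedBounds_of_re_form_le {lam : ℝ} (hlam : 1 / 2 < lam) {f : Lp ℂ 2 (vol U)}
    (hf : ∃ K : Set (Euc d), IsCompact K ∧ ∀ᵐ x ∂(vol U), x ∉ K → f x = 0) (x₀ : Euc d) {u : H1 U}
    (hu : ∀ (η : Euc d → ℝ) (h : IsSlowWeight η),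
      (form lam u (h.mulH1 u)).re ≤ (rhs f (h.mulH1 u)).re) :
    WeightedBounds (max 2 (lam - 1 / 2)⁻¹) x₀ f u := by
  have hF (ε : ℝ) (hε : 0 < ε) : max 2 (lam - 1 / 2)⁻¹ * ∫ x in U, ‖f x‖ ^ 2 * regWeight ε x₀ x ≤
      Real.exp ε * (max 2 (lam - 1 / 2)⁻¹ * ∫ x in U, ‖f x‖ ^ 2 * weight x₀ x) := by
    have hi := (isSlowWeight_regWeight hε x₀).integrable_norm_sq (Lp.memLp f)
    rw [mul_left_comm, ← integral_const_mul (Real.exp ε)]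
    gcongr ?_ * ?_
    refine integral_mono hi
      ((integrable_weight_of_compact_support hf x₀).const_mul _) fun x => ?_
    have := mul_le_mul_of_nonneg_left (regWeight_le hε x₀ x) (sq_nonneg ‖f x‖)
    simp only
    linarith
  exact ⟨integral_weight_le (Lp.memLp u.val).1 x₀
      (fun ε hε => (isSlowWeight_regWeight hε x₀).integrable_norm_sq (Lp.memLp u.val))
      fun ε hε => ((isSlowWeight_regWeight hε x₀).integral_le hlam (hu _ _)).1.trans (hF ε hε),
    integral_weight_le (Lp.memLp u.grad).1 x₀
      (fun ε hε => (isSlowWeight_regWeight hε x₀).integrable_norm_sq (Lp.memLp u.grad))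
      fun ε hε => ((isSlowWeight_regWeight hε x₀).integral_le hlam (hu _ _)).2.trans (hF ε hε)⟩

/-! ### Complex Lax–Milgram on a closed subspace -/

lemma existsUnique_of_coercive {E : Type*} [NormedAddCommGroup E] [InnerProductSpace ℂ E]
    [CompleteSpace E] {S : Submodule ℂ E} (hS : IsClosed (S : Set E)) (A : E →L[ℂ] E) {c : ℝ}
    (hc : 0 < c) (hA : ∀ w, c * ‖w‖ ^ 2 ≤ ‖inner ℂ w (A w)‖) (b : E) :
    ∃! w, w ∈ S ∧ ∀ v ∈ S, inner ℂ v (A w) = inner ℂ v b := by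
  have : CompleteSpace S := hS.completeSpace_coe
  let T : S →L[ℂ] S := S.orthogonalProjectionOnto ∘L A ∘L S.subtypeL
  have hT : IsUnit T := by
    refine T.isUnit_of_forall_le_norm_inner_map (c := ⟨c, hc.le⟩) hc fun x => ?_
    have e : inner ℂ (T x) x = inner ℂ (A x) (x : E) := by
      simp [T]
    rw [e, norm_inner_symm, mul_comm]
    exact hA x
  have hbij := ContinuousLinearMap.isUnit_iff_bijective.mp hT
  obtain ⟨w, hw⟩ := hbij.2 (S.orthogonalProjectionOnto b)
  refine ⟨w, ⟨w.2, fun v hv => ?_⟩, fun w' hw' => ?_⟩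
  · have h1 := Submodule.inner_orthogonalProjectionOnto_eq_of_mem_left (⟨v, hv⟩ : S) (A w)
    have h2 := Submodule.inner_orthogonalProjectionOnto_eq_of_mem_left (⟨v, hv⟩ : S) b
    rw [← hw] at h2
    exact h1.symm.trans h2
  · have h1 : T ⟨w', hw'.1⟩ = S.orthogonalProjectionOnto b := by
      refine ext_inner_left ℂ fun v => ?_
      have h1 := Submodule.inner_orthogonalProjectionOnto_eq_of_mem_left v (A w')
      have h2 := Submodule.inner_orthogonalProjectionOnto_eq_of_mem_left v b
      rw [Submodule.coe_inner, Submodule.coe_inner]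
      exact h1.trans ((hw'.2 v v.2).trans h2.symm)
    exact congrArg Subtype.val (hbij.1 (h1.trans hw.symm))

/-! ### The Hilbert space of functions, gradients and boundary values -/

/-- The Hilbert space `L²(U) × L²(U)^d × L²(∂U)`, in which each of the three boundary value problems
lives on a closed subspace of triples `(u, ∇u, g)`. -/
abbrev Triple (U : Set (Euc d)) : Type :=
  WithLp 2 (Lp ℂ 2 (vol U) × WithLp 2 (Lp (EuclideanSpace ℂ (Fin d)) 2 (vol U) ×
    Lp ℂ 2 (surface U)))

/-- The triple `(u, ∇u, g)`. -/
noncomputable def triple (u : H1 U) (g : Lp ℂ 2 (surface U)) : Triple U :=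
  WithLp.toLp 2 (u.val, WithLp.toLp 2 (u.grad, g))

/-- The function component of a triple. -/
noncomputable def valL (U : Set (Euc d)) : Triple U →L[ℂ] Lp ℂ 2 (vol U) :=
  WithLp.fstL 2 ℂ _ _

/-- The gradient component of a triple. -/
noncomputable def gradL (U : Set (Euc d)) :
    Triple U →L[ℂ] Lp (EuclideanSpace ℂ (Fin d)) 2 (vol U) :=
  WithLp.fstL 2 ℂ _ _ ∘L WithLp.sndL 2 ℂ _ _

/-- The boundary component of a triple. -/
noncomputable def bdryL (U : Set (Euc d)) : Triple U →L[ℂ] Lp ℂ 2 (surface U) :=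
  WithLp.sndL 2 ℂ _ _ ∘L WithLp.sndL 2 ℂ _ _

lemma inner_triple (v w : Triple U) :
    inner ℂ v w = inner ℂ (valL U v) (valL U w) + (inner ℂ (gradL U v) (gradL U w) +
      inner ℂ (bdryL U v) (bdryL U w)) := rfl

lemma triple_ext {v w : Triple U} (h1 : valL U v = valL U w) (h2 : gradL U v = gradL U w)
    (h3 : bdryL U v = bdryL U w) : v = w :=
  WithLp.ofLp_injective 2 (Prod.ext h1 (WithLp.ofLp_injective 2 (Prod.ext h2 h3)))

@[simp] lemma valL_triple (u : H1 U) (g : Lp ℂ 2 (surface U)) : valL U (triple u g) = u.val := rfl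
@[simp] lemma gradL_triple (u : H1 U) (g : Lp ℂ 2 (surface U)) :
    gradL U (triple u g) = u.grad := rfl
@[simp] lemma bdryL_triple (u : H1 U) (g : Lp ℂ 2 (surface U)) : bdryL U (triple u g) = g := rfl

/-- The operator `(u, G, g) ↦ (lam u, G, α g)` that represents the Robin form. -/
noncomputable def robinOp (U : Set (Euc d)) (lam : ℝ) (α : ℂ) : Triple U →L[ℂ] Triple U :=
  (WithLp.prodContinuousLinearEquiv 2 ℂ _ _).symm.toContinuousLinearMap ∘L
    (((lam : ℂ) • valL U).prod
      ((WithLp.prodContinuousLinearEquiv 2 ℂ _ _).symm.toContinuousLinearMap ∘L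
        ((gradL U).prod (α • bdryL U))))

lemma inner_robinOp (lam : ℝ) (α : ℂ) (v w : Triple U) :
    inner ℂ v (robinOp U lam α w) = lam * inner ℂ (valL U v) (valL U w) +
      (inner ℂ (gradL U v) (gradL U w) + α * inner ℂ (bdryL U v) (bdryL U w)) := by
  rw [← inner_smul_right, ← inner_smul_right]
  rfl

/-- The Robin form is coercive, with the boundary values included in the norm: as `Re α ≥ 0`,
`|P + α Q| ≥ (P + |α| Q) / 2` for `P, Q ≥ 0`. The constant is
positive if `α ≠ 0`. -/
lemma robinOp_coercive {lam : ℝ} (hlam : 1 / 2 < lam) {α : ℂ} (hα : 0 ≤ α.re)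
    (w : Triple U) :
    min (1 / 4) (‖α‖ / 2) * ‖w‖ ^ 2 ≤ ‖inner ℂ w (robinOp U lam α w)‖ := by
  have hw : ‖w‖ ^ 2 = ‖valL U w‖ ^ 2 + (‖gradL U w‖ ^ 2 + ‖bdryL U w‖ ^ 2) := by
    have h := congrArg Complex.re (inner_triple w w)
    simp only [inner_self_eq_norm_sq_to_K] at h
    exact_mod_cast h
  rw [inner_robinOp, hw]
  simp only [inner_self_eq_norm_sq_to_K, Complex.coe_algebraMap]
  set a := ‖valL U w‖ ^ 2
  set b := ‖gradL U w‖ ^ 2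
  set g := ‖bdryL U w‖ ^ 2
  have ha : 0 ≤ a := by positivity
  have hb : 0 ≤ b := by positivity
  have hg : 0 ≤ g := by positivity
  rw [← Complex.ofReal_pow, ← Complex.ofReal_pow, ← Complex.ofReal_pow]
  have hP : a / 2 + b ≤ lam * a + b := by nlinarith
  set P := lam * a + b with hPdef
  have hP0 : 0 ≤ P := by linarith
  have ez : (lam : ℂ) * (a : ℂ) + (b + α * g) = P + α * g := by
    rw [hPdef]; push_cast; ring
  have key : (P + ‖α‖ * g) / 2 ≤ ‖(lam : ℂ) * (a : ℂ) + (b + α * g)‖ := by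
    rw [ez]
    refine le_of_sq_le_sq ?_ (norm_nonneg _)
    have hn : ‖α‖ ^ 2 = α.re * α.re + α.im * α.im := by rw [Complex.sq_norm, Complex.normSq_apply]
    rw [Complex.sq_norm, Complex.normSq_apply]
    simp only [Complex.add_re, Complex.add_im, Complex.mul_re, Complex.mul_im, Complex.ofReal_re,
      Complex.ofReal_im, mul_zero, sub_zero, zero_add]
    nlinarith [sq_nonneg (P - ‖α‖ * g), mul_nonneg (mul_nonneg hP0 hα) hg, sq_nonneg P,
      mul_nonneg (sq_nonneg ‖α‖) (sq_nonneg g), congrArg (· * g ^ 2) hn]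
  have h1 : min (1 / 4) (‖α‖ / 2) * a ≤ 1 / 4 * a := by gcongr; exact min_le_left _ _
  have h2 : min (1 / 4) (‖α‖ / 2) * b ≤ 1 / 4 * b := by gcongr; exact min_le_left _ _
  have h3 : min (1 / 4) (‖α‖ / 2) * g ≤ ‖α‖ / 2 * g := by gcongr; exact min_le_right _ _
  linarith

/-! ### Weak gradients form a closed subspace -/

lemma IsTest.memLp_conj_pderiv {φ : Euc d → ℂ} (h : IsTest U φ) (i : Fin d) :
    MemLp (fun x => starRingEnd ℂ (pderiv φ i x)) 2 (vol U) :=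
  (memLp_two_of_continuous_of_hasCompactSupport (continuous_pderiv h.1 i)
    (hasCompactSupport_pderiv h.2.1 i)).star

lemma IsTest.memLp_conj_single {φ : Euc d → ℂ} (h : IsTest U φ) (i : Fin d) :
    MemLp (fun x => EuclideanSpace.single i (starRingEnd ℂ (φ x))) 2 (vol U) := by
  refine (memLp_two_of_continuous_of_hasCompactSupport (U := U) h.1.continuous h.2.1).star.mono
    ?_ (Eventually.of_forall fun x => by simp)
  have : Continuous fun x => EuclideanSpace.single i (starRingEnd ℂ (φ x)) :=
    (PiLp.continuous_toLp 2 _).comp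
      ((continuous_single i).comp (Complex.continuous_conj.comp h.1.continuous))
  exact this.aestronglyMeasurable

/-- The functional `(u, G, g) ↦ ∫ u ∂ᵢφ + ∫ Gᵢ φ`, which vanishes for all test functions `φ`
exactly if `G` is the weak gradient of `u`. -/
noncomputable def gradDefect {φ : Euc d → ℂ} (h : IsTest U φ) (i : Fin d) : Triple U →L[ℂ] ℂ :=
  innerSL ℂ ((h.memLp_conj_pderiv i).toLp _) ∘L valL U +
    innerSL ℂ ((h.memLp_conj_single i).toLp _) ∘L gradL U

lemma gradDefect_apply {φ : Euc d → ℂ} (h : IsTest U φ) (i : Fin d) (w : Triple U) :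
    gradDefect h i w = (∫ x in U, valL U w x * pderiv φ i x) + ∫ x in U, gradL U w x i * φ x := by
  simp only [gradDefect, add_apply, ContinuousLinearMap.comp_apply,
    innerSL_apply_apply, L2.inner_def]
  congr 1
  · refine integral_congr_ae ?_
    filter_upwards [MemLp.coeFn_toLp (h.memLp_conj_pderiv i)] with x hx
    simp [hx, RCLike.inner_apply]
  · refine integral_congr_ae ?_
    filter_upwards [MemLp.coeFn_toLp (h.memLp_conj_single i)] with x hx
    simp [hx, EuclideanSpace.inner_single_left, mul_comm]

/-- The triples `(u, G, g)` in which `G` is the weak gradient of `u`. -/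
noncomputable def weakGradSpace (U : Set (Euc d)) : Submodule ℂ (Triple U) :=
  ⨅ (φ : {φ : Euc d → ℂ // IsTest U φ}) (i : Fin d), (gradDefect φ.2 i).ker

lemma mem_weakGradSpace {w : Triple U} : w ∈ weakGradSpace U ↔ ∀ φ : Euc d → ℂ, IsTest U φ →
    ∀ i : Fin d, ∫ x in U, valL U w x * pderiv φ i x = -∫ x in U, gradL U w x i * φ x := by
  simp only [weakGradSpace, Submodule.mem_iInf, Subtype.forall, LinearMap.mem_ker,
    ContinuousLinearMap.coe_coe, gradDefect_apply, eq_neg_iff_add_eq_zero]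

lemma isClosed_weakGradSpace : IsClosed (weakGradSpace U : Set (Triple U)) := by
  simp only [weakGradSpace, Submodule.coe_iInf]
  exact isClosed_iInter fun φ => isClosed_iInter fun i => (gradDefect φ.2 i).isClosed_ker

lemma triple_mem_weakGradSpace (u : H1 U) (g : Lp ℂ 2 (surface U)) :
    triple u g ∈ weakGradSpace U :=
  mem_weakGradSpace.mpr fun φ hφ => u.isWeakGrad φ hφ.1 hφ.2.1 hφ.2.2

lemma exists_eq_triple {w : Triple U} (hw : w ∈ weakGradSpace U) :
    ∃ u : H1 U, w = triple u (bdryL U w) :=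
  ⟨⟨valL U w, gradL U w, fun φ h1 h2 h3 => mem_weakGradSpace.mp hw φ ⟨h1, h2, h3⟩⟩,
    triple_ext rfl rfl rfl⟩

/-! ### Limits of smooth functions -/

/-- The triples `(φ|_U, ∇φ|_U, φ|_∂U)` with `φ` in `C_c^∞(V)`, provided that `φ` is square
integrable over `∂U`. -/
noncomputable def smoothSpace (U V : Set (Euc d)) : Submodule ℂ (Triple U) where
  carrier := {w | ∃ φ, IsTest V φ ∧ valL U w =ᵐ[vol U] φ ∧ gradL U w =ᵐ[vol U] cgrad φ ∧
    bdryL U w =ᵐ[surface U] φ}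
  add_mem' := by
    rintro v w ⟨φ, h1, h2, h3, h4⟩ ⟨ψ, k1, k2, k3, k4⟩
    refine ⟨fun x => φ x + ψ x, ⟨h1.1.add k1.1, h1.2.1.add k1.2.1,
      (tsupport_add φ ψ).trans (Set.union_subset h1.2.2 k1.2.2)⟩, ?_, ?_, ?_⟩
    · rw [map_add]
      filter_upwards [Lp.coeFn_add (valL U v) (valL U w), h2, k2] with x e1 e2 e3
      rw [e1, Pi.add_apply, e2, e3]
    · rw [map_add]
      filter_upwards [Lp.coeFn_add (gradL U v) (gradL U w), h3, k3] with x e1 e2 e3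
      rw [e1, Pi.add_apply, e2, e3, cgrad_add h1.1 k1.1]
    · rw [map_add]
      filter_upwards [Lp.coeFn_add (bdryL U v) (bdryL U w), h4, k4] with x e1 e2 e3
      rw [e1, Pi.add_apply, e2, e3]
  zero_mem' := by
    refine ⟨fun _ => 0, ⟨contDiff_const, HasCompactSupport.zero, by simp [tsupport]⟩, ?_, ?_, ?_⟩
    · rw [map_zero]; exact Lp.coeFn_zero _ _ _
    · rw [map_zero]
      filter_upwards [Lp.coeFn_zero (EuclideanSpace ℂ (Fin d)) 2 (vol U)] with x hx
      rw [hx]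
      ext i
      simp [cgrad, pderiv]
    · rw [map_zero]; exact Lp.coeFn_zero _ _ _
  smul_mem' := by
    rintro c w ⟨φ, h1, h2, h3, h4⟩
    refine ⟨fun x => c * φ x, ⟨contDiff_const.mul h1.1, h1.2.1.mul_left,
      tsupport_mul_subset_right.trans h1.2.2⟩, ?_, ?_, ?_⟩
    · rw [map_smul]
      filter_upwards [Lp.coeFn_smul c (valL U w), h2] with x e1 e2
      simp [e1, e2]
    · rw [map_smul]
      filter_upwards [Lp.coeFn_smul c (gradL U w), h3] with x e1 e2
      simp [e1, e2, cgrad_const_mul c h1.1]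
    · rw [map_smul]
      filter_upwards [Lp.coeFn_smul c (bdryL U w), h4] with x e1 e2
      simp [e1, e2]

/-- Integration by parts: the classical gradient is the weak one. -/
lemma integral_mul_pderiv {φ ψ : Euc d → ℂ} (hφ : ContDiff ℝ ∞ φ) (hc : HasCompactSupport φ)
    (hψ : IsTest U ψ) (i : Fin d) :
    ∫ x in U, φ x * pderiv ψ i x = -∫ x in U, pderiv φ i x * ψ x := by
  have hψ0 {x : Euc d} (hx : x ∉ U) : x ∉ tsupport ψ := fun h => hx (hψ.2.2 h)
  rw [setIntegral_eq_integral_of_forall_compl_eq_zero fun x hx => ?_,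
    setIntegral_eq_integral_of_forall_compl_eq_zero fun x hx => ?_]
  · refine integral_mul_fderiv_eq_neg_fderiv_mul_of_integrable ?_ ?_ ?_
      (fun x _ => hφ.differentiable (by simp) x) fun x _ => hψ.1.differentiable (by simp) x
    · exact ((continuous_pderiv hφ i).mul hψ.1.continuous).integrable_of_hasCompactSupport
        hψ.2.1.mul_left
    · exact (hφ.continuous.mul (continuous_pderiv hψ.1 i)).integrable_of_hasCompactSupport
        hc.mul_right
    · exact (hφ.continuous.mul hψ.1.continuous).integrable_of_hasCompactSupport hc.mul_right
  · rw [image_eq_zero_of_notMem_tsupport (hψ0 hx), mul_zero]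
  · have : fderiv ℝ ψ x = 0 := by
      by_contra h
      exact hψ0 hx (support_fderiv_subset ℝ h)
    simp [pderiv, this]

lemma smoothSpace_le_weakGradSpace (V : Set (Euc d)) : smoothSpace U V ≤ weakGradSpace U := by
  rintro w ⟨φ, h1, h2, h3, -⟩
  refine mem_weakGradSpace.mpr fun ψ hψ i => ?_
  have e1 : ∫ x in U, valL U w x * pderiv ψ i x = ∫ x in U, φ x * pderiv ψ i x := by
    refine integral_congr_ae ?_
    filter_upwards [h2] with x hx
    rw [hx]
  have e2 : ∫ x in U, gradL U w x i * ψ x = ∫ x in U, pderiv φ i x * ψ x := by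
    refine integral_congr_ae ?_
    filter_upwards [h3] with x hx
    rw [hx]
    rfl
  rw [e1, e2, integral_mul_pderiv h1.1 h1.2.1 hψ]

lemma closure_smoothSpace_le_weakGradSpace (V : Set (Euc d)) :
    (smoothSpace U V).topologicalClosure ≤ weakGradSpace U :=
  Submodule.topologicalClosure_minimal _ (smoothSpace_le_weakGradSpace V) isClosed_weakGradSpace

lemma tendsto_triple_iff {w : ℕ → Triple U} {v : Triple U} :
    Tendsto w atTop (𝓝 v) ↔ Tendsto (fun n => valL U (w n)) atTop (𝓝 (valL U v)) ∧
      Tendsto (fun n => gradL U (w n)) atTop (𝓝 (gradL U v)) ∧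
      Tendsto (fun n => bdryL U (w n)) atTop (𝓝 (bdryL U v)) := by
  refine ⟨fun h => ⟨((valL U).continuous.tendsto v).comp h, ((gradL U).continuous.tendsto v).comp h,
    ((bdryL U).continuous.tendsto v).comp h⟩, fun ⟨h1, h2, h3⟩ => ?_⟩
  exact ((WithLp.prod_continuous_toLp 2 _ _).tendsto _).comp (h1.prodMk_nhds
    (((WithLp.prod_continuous_toLp 2 _ _).tendsto _).comp (h2.prodMk_nhds h3)))

/-- Convergence in `L²` to `g`, for a sequence of elements of `L²` that are given by functions. -/
lemma tendsto_iff_eLpNorm {E : Type*} [NormedAddCommGroup E] {μ : Measure (Euc d)}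
    {φ : ℕ → Euc d → E} {F : ℕ → Lp E 2 μ} {g : Lp E 2 μ} (h : ∀ n, F n =ᵐ[μ] φ n) :
    Tendsto F atTop (𝓝 g) ↔ Tendsto (fun n => eLpNorm (fun x => φ n x - g x) 2 μ) atTop (𝓝 0) := by
  rw [Lp.tendsto_Lp_iff_tendsto_eLpNorm']
  have (n : ℕ) : eLpNorm (⇑(F n) - ⇑g) 2 μ = eLpNorm (fun x => φ n x - g x) 2 μ := by
    refine eLpNorm_congr_ae ?_
    filter_upwards [h n] with x hx
    simp [hx]
  simp only [this]

lemma isApprox_iff {V : Set (Euc d)} {u : H1 U} {g : Lp ℂ 2 (surface U)} :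
    IsApprox V u g ↔ triple u g ∈ (smoothSpace U V).topologicalClosure := by
  rw [← SetLike.mem_coe, Submodule.topologicalClosure_coe, mem_closure_iff_seq_limit]
  constructor
  · rintro ⟨φ, h1, h2, h3⟩
    have m1 (n : ℕ) : MemLp (φ n) 2 (vol U) :=
      memLp_two_of_continuous_of_hasCompactSupport (h1 n).1.continuous (h1 n).2.1
    have m2 (n : ℕ) : MemLp (cgrad (φ n)) 2 (vol U) :=
      memLp_two_of_continuous_of_hasCompactSupport (continuous_cgrad (h1 n).1)
        (hasCompactSupport_cgrad (h1 n).2.1)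
    -- Square integrability on `∂U` is not known in advance, but follows from the convergence.
    obtain ⟨N, hN⟩ := eventually_atTop.mp (h3.eventually (gt_mem_nhds ENNReal.zero_lt_top))
    have m3 (n : ℕ) : MemLp (φ (n + N)) 2 (surface U) := by
      have : MemLp (fun x => φ (n + N) x - g x) 2 (surface U) :=
        ⟨(h1 _).1.continuous.aestronglyMeasurable.sub (Lp.memLp g).1, hN _ (by omega)⟩
      refine (this.add (Lp.memLp g)).ae_eq (Eventually.of_forall fun x => ?_)
      simp
    refine ⟨fun n => WithLp.toLp 2 ((m1 (n + N)).toLp _,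
      WithLp.toLp 2 ((m2 (n + N)).toLp _, (m3 n).toLp _)), fun n => ?_, ?_⟩
    · exact ⟨φ (n + N), h1 _, MemLp.coeFn_toLp (m1 _), MemLp.coeFn_toLp (m2 _),
        MemLp.coeFn_toLp (m3 n)⟩
    · refine tendsto_triple_iff.mpr ⟨?_, ?_, ?_⟩
      · exact (tendsto_iff_eLpNorm fun n => MemLp.coeFn_toLp (m1 (n + N))).mpr
          ((tendsto_add_atTop_iff_nat N).mpr h2.1)
      · exact (tendsto_iff_eLpNorm fun n => MemLp.coeFn_toLp (m2 (n + N))).mpr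
          ((tendsto_add_atTop_iff_nat N).mpr h2.2)
      · exact (tendsto_iff_eLpNorm fun n => MemLp.coeFn_toLp (m3 n)).mpr
          ((tendsto_add_atTop_iff_nat N).mpr h3)
  · rintro ⟨w, hw, hlim⟩
    choose φ h1 h2 h3 h4 using hw
    obtain ⟨k1, k2, k3⟩ := tendsto_triple_iff.mp hlim
    exact ⟨φ, h1, ⟨(tendsto_iff_eLpNorm h2).mp k1, (tendsto_iff_eLpNorm h3).mp k2⟩,
      (tendsto_iff_eLpNorm h4).mp k3⟩

lemma IsApprox.eq_zero (hU : IsOpen U) {u : H1 U} {g : Lp ℂ 2 (surface U)} (h : IsApprox U u g) :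
    g = 0 := by
  obtain ⟨φ, h1, -, h3⟩ := h
  have (n : ℕ) : eLpNorm (fun x => φ n x - g x) 2 (surface U) = eLpNorm g 2 (surface U) := by
    rw [← eLpNorm_neg]
    refine eLpNorm_congr_ae ?_
    filter_upwards [ae_surface_eq_zero hU (h1 n).2.2] with x hx
    simp [hx]
  simp only [this] at h3
  have h0 := tendsto_nhds_unique tendsto_const_nhds h3
  exact (Lp.eq_zero_iff_ae_eq_zero).mpr
    ((eLpNorm_eq_zero_iff (Lp.memLp g).1 (by norm_num)).mp h0)

/-! ### The three boundary value problems -/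

/-- Unique solvability for any class `P` of pairs (function, boundary values) that corresponds to a
closed subspace `S` of triples. Uniqueness of the boundary values for a given function is not
presupposed. -/
lemma existsUnique_solution {lam : ℝ} (hlam : 1 / 2 < lam) {α : ℂ} (hα0 : α ≠ 0) (hα : 0 ≤ α.re)
    (f : Lp ℂ 2 (vol U)) {S : Submodule ℂ (Triple U)} (hS : IsClosed (S : Set (Triple U)))
    (hSw : S ≤ weakGradSpace U) {P : H1 U → Lp ℂ 2 (surface U) → Prop}
    (hP : ∀ u g, P u g ↔ triple u g ∈ S) :
    ∃! u : H1 U, ∃ g, P u g ∧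
      ∀ v h, P v h → form lam u v + α * inner ℂ h g = rhs f v := by
  have hc : 0 < min (1 / 4) (‖α‖ / 2) := lt_min (by norm_num) (by positivity)
  obtain ⟨w, ⟨hwS, hw⟩, hun⟩ := existsUnique_of_coercive hS (robinOp U lam α) hc
    (robinOp_coercive hlam hα) (WithLp.toLp 2 (f, 0))
  have hiff (u v : H1 U) (g h : Lp ℂ 2 (surface U)) :
      inner ℂ (triple v h) (robinOp U lam α (triple u g)) =
        inner ℂ (triple v h) (WithLp.toLp 2 (f, 0) : Triple U) ↔
      form lam u v + α * inner ℂ h g = rhs f v := by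
    have e : inner ℂ (triple v h) (WithLp.toLp 2 (f, 0) : Triple U) = rhs f v := by
      rw [rhs_eq_inner, WithLp.prod_inner_apply, inner_zero_right, add_zero]
      rfl
    rw [inner_robinOp, e, form_eq_inner]
    simp only [valL_triple, gradL_triple, bdryL_triple]
    rw [← add_assoc, add_comm (_ * _) (inner ℂ v.grad u.grad)]
  obtain ⟨u, hu⟩ := exists_eq_triple (hSw hwS)
  rw [hu] at hwS hw
  refine ⟨u, ⟨_, (hP _ _).mpr hwS, fun v h hv => (hiff _ _ _ _).mp (hw _ ((hP _ _).mp hv))⟩, ?_⟩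
  rintro u' ⟨g', hg', heq⟩
  have h1 : triple u' g' = w := by
    refine hun _ ⟨(hP _ _).mp hg', fun v hv => ?_⟩
    obtain ⟨v', hv'⟩ := exists_eq_triple (hSw hv)
    rw [hv'] at hv ⊢
    exact (hiff _ _ _ _).mpr (heq _ _ ((hP _ _).mpr hv))
  have h2 := h1.trans hu
  exact H1.ext (congrArg (valL U) h2) (congrArg (gradL U) h2)

lemma integral_mul_conj_eq_inner {μ : Measure (Euc d)} (g h : Lp ℂ 2 μ) :
    ∫ x, g x * starRingEnd ℂ (h x) ∂μ = inner ℂ h g := by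
  simp [L2.inner_def, RCLike.inner_apply]

lemma existsUnique_isRobinSolution {lam : ℝ} (hlam : 1 / 2 < lam) {α : ℂ} (hα0 : α ≠ 0)
    (hα : 0 ≤ α.re) (f : Lp ℂ 2 (vol U)) : ∃! u : H1 U, IsRobinSolution lam α f u := by
  simp only [IsRobinSolution, integral_mul_conj_eq_inner]
  exact existsUnique_solution hlam hα0 hα f
    (smoothSpace U Set.univ).isClosed_topologicalClosure
    (closure_smoothSpace_le_weakGradSpace _) fun u g => isApprox_univ_iff.symm.trans isApprox_iff

/-- The Neumann problem is posed on `H^1(U) × {0}`, where the coefficient `α = 1` has no effect. -/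
lemma existsUnique_isNeumannSolution {lam : ℝ} (hlam : 1 / 2 < lam) (f : Lp ℂ 2 (vol U)) :
    ∃! u : H1 U, IsNeumannSolution lam f u := by
  have h := existsUnique_solution hlam one_ne_zero (by simp) f
    (S := weakGradSpace U ⊓ (bdryL U).ker) (isClosed_weakGradSpace.inter (bdryL U).isClosed_ker)
    inf_le_left (P := fun _ g => g = 0) fun u g => by
      simp [triple_mem_weakGradSpace]
  simpa [IsNeumannSolution] using h

/-- The Dirichlet problem is posed on the closure of the triples of `C_c^∞(U)`, whose boundary
components are `0`. -/
lemma existsUnique_isDirichletSolution (hU : IsOpen U) {lam : ℝ} (hlam : 1 / 2 < lam)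
    (f : Lp ℂ 2 (vol U)) : ∃! u : H1 U, IsDirichletSolution lam f u := by
  have h := existsUnique_solution hlam one_ne_zero (by simp) f
    (smoothSpace U U).isClosed_topologicalClosure (closure_smoothSpace_le_weakGradSpace _)
    (P := IsApprox U) fun u g => isApprox_iff
  refine (existsUnique_congr fun u => ?_).mp h
  constructor
  · rintro ⟨g, hg, heq⟩
    obtain rfl := hg.eq_zero hU
    exact ⟨(isApprox_self_iff hU).mp hg, fun v hv => by
      simpa using heq v 0 ((isApprox_self_iff hU).mpr hv)⟩
  · rintro ⟨hu, heq⟩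
    refine ⟨0, (isApprox_self_iff hU).mpr hu, fun v h hv => ?_⟩
    obtain rfl := hv.eq_zero hU
    simpa using heq v ((isApprox_self_iff hU).mp hv)

/-- Tested with `η u`, the boundary term `α ∫ |g|² η` has nonnegative real part. -/
lemma IsRobinSolution.re_form_le {lam : ℝ} {α : ℂ} (hα : 0 ≤ α.re) {f : Lp ℂ 2 (vol U)} {u : H1 U}
    (hu : IsRobinSolution lam α f u) {η : Euc d → ℝ} (h : IsSlowWeight η) :
    (form lam u (h.mulH1 u)).re ≤ (rhs f (h.mulH1 u)).re := by
  obtain ⟨g, hg, heq⟩ := hu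
  have htr : IsTrace (h.mulH1 u) (h.mulLp g) :=
    isApprox_univ_iff.mp ((isApprox_univ_iff.mpr hg).mul h)
  have e : ∫ x, g x * starRingEnd ℂ (h.mulLp g x) ∂(surface U) =
      ((∫ x, ‖g x‖ ^ 2 * η x ∂(surface U) : ℝ) : ℂ) := by
    rw [← integral_complex_ofReal]
    refine integral_congr_ae ?_
    filter_upwards [h.coeFn_mulLp g] with x hx
    rw [hx, smul_eq_mul, map_mul, Complex.conj_ofReal, mul_left_comm, Complex.mul_conj,
      Complex.normSq_eq_norm_sq]
    push_cast
    ring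
  have h0 : 0 ≤ ∫ x, ‖g x‖ ^ 2 * η x ∂(surface U) :=
    integral_nonneg fun x => mul_nonneg (by positivity) (h.nonneg x)
  rw [← heq _ _ htr, e, Complex.add_re, Complex.re_mul_ofReal]
  exact le_add_of_nonneg_right (mul_nonneg hα h0)

end WeightedDecay

theorem proposition5p1 (d : ℕ) (hd : 2 ≤ d)
    (U : Set (EuclideanSpace ℝ (Fin d))) (hU : IsOpen U)
    (hLip : WeightedDecay.StrongLocalLipschitz U)
    (lam : ℝ) (hlam : 1 / 2 < lam) (α : ℂ) (hα0 : α ≠ 0) (hα : 0 ≤ α.re)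
    (f : Lp ℂ 2 (volume.restrict U))
    (hf : ∃ K : Set (EuclideanSpace ℝ (Fin d)), IsCompact K ∧
      ∀ᵐ x ∂(volume.restrict U), x ∉ K → f x = 0)
    (x₀ : EuclideanSpace ℝ (Fin d)) :
    ((∃! u : WeightedDecay.H1 U, WeightedDecay.IsRobinSolution lam α f u) ∧
      ∀ u : WeightedDecay.H1 U, WeightedDecay.IsRobinSolution lam α f u →
        WeightedDecay.WeightedBounds (max 2 (lam - 1 / 2)⁻¹) x₀ f u) ∧
    ((∃! u : WeightedDecay.H1 U, WeightedDecay.IsNeumannSolution lam f u) ∧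
      ∀ u : WeightedDecay.H1 U, WeightedDecay.IsNeumannSolution lam f u →
        WeightedDecay.WeightedBounds (max 2 (lam - 1 / 2)⁻¹) x₀ f u) ∧
    ((∃! u : WeightedDecay.H1 U, WeightedDecay.IsDirichletSolution lam f u) ∧
      ∀ u : WeightedDecay.H1 U, WeightedDecay.IsDirichletSolution lam f u →
        WeightedDecay.WeightedBounds (max 2 (lam - 1 / 2)⁻¹) x₀ f u) := by
  refine ⟨⟨WeightedDecay.existsUnique_isRobinSolution hlam hα0 hα f, fun u hu => ?_⟩,
    ⟨WeightedDecay.existsUnique_isNeumannSolution hlam f, fun u hu => ?_⟩,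
    ⟨WeightedDecay.existsUnique_isDirichletSolution hU hlam f, fun u hu => ?_⟩⟩
  · exact WeightedDecay.weightedBounds_of_re_form_le hlam hf x₀ fun η h => hu.re_form_le hα h
  · exact WeightedDecay.weightedBounds_of_re_form_le hlam hf x₀ fun η h =>
      (congrArg Complex.re (hu (h.mulH1 u))).le
  · exact WeightedDecay.weightedBounds_of_re_form_le hlam hf x₀ fun η h =>
      (congrArg Complex.re (hu.2 _ (hu.1.mul hU h))).le
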